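/- A countable Borel equivalence relation is an equivalence relation $E$ on a Polish space $X$ that is Borel as a subset of $X\times X$ and all of whose classes are countable. For Borel equivalence relations $E$ on $X$ and $F$ on $Y$, write $E\le_B F$ if there is a Borel map $f:X\to Y$ with $x\mathrel{E}y\iff f(x)\mathrel{F}f(y)$ for all $x,y\in X$, and write $E\sim_B F$ if $E\le_B F$ and $F\le_B E$. Let $E\times F$ be the relation on $X\times Y$ given by $(x,y)\mathrel{(E\times F)}(x',y')\iff x\mathrel{E}x'\text{ and }y\mathrel{F}y'$. A countable Borel equivalence relation $E$ is universal if $F\le_B E$ for every countable Borel equivalence relation $F$ on a Polish space. Let $\equiv_T$ be Turing equivalence on $2^{\mathbb N}$, and let $\mathcal D=2^{\mathbb N}/{\equiv_T}$ be the set of Turing degrees, with $[x]_T$ the degree of $x$. 1. If $E$ is a universal countable Borel equivalence relation, then $E\times E\sim_B E$. 2. If $\equiv_T$ is a universal countable Borel equivalence relation, then $({\equiv_T})\times({\equiv_T})\sim_B({\equiv_T})$, and there is a Borel pairing function on $\mathcal D$, that is, a bijection $f:\mathcal D^2\to\mathcal D$ for which there is a Borel function $F:2^{\mathbb N}\times 2^{\mathbb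 N}\to 2^{\mathbb N}$ with $f([x]_T,[y]_T)=[F(x,y)]_T$ for all $x,y\in 2^{\mathbb N}$. -/

import Mathlib

/-- `E` is a countable Borel equivalence relation on `X`: it is Borel as a subset of `X × X`,
and each of its classes is countable. -/
structure IsCountableBorelEquiv {X : Type*} [MeasurableSpace X] (E : Setoid X) : Prop where
  borel : MeasurableSet {p : X × X | E p.1 p.2}
  countable_class : ∀ x : X, {y : X | E x y}.Countable

/-- `E ≤_B F`: there is a Borel map `f : X → Y` with `x E y ↔ f x F f y`. -/
def BorelReducible {X Y : Type*} [MeasurableSpace X] [MeasurableSpace Y]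
    (E : Setoid X) (F : Setoid Y) : Prop :=
  ∃ f : X → Y, Measurable f ∧ ∀ x y : X, E x y ↔ F (f x) (f y)

/-- `E ∼_B F`: each of `E` and `F` is Borel reducible to the other. -/
def BorelBireducible {X Y : Type*} [MeasurableSpace X] [MeasurableSpace Y]
    (E : Setoid X) (F : Setoid Y) : Prop :=
  BorelReducible E F ∧ BorelReducible F E

/-- `E` is a universal countable Borel equivalence relation: it is a countable Borel equivalence
relation, and every countable Borel equivalence relation on a Polish space is Borel reducible
to it. Polish spaces in `Type` suffice, as every Polish space is homeomorphic to one of these. -/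
structure IsUniversalCountableBorelEquiv {X : Type*} [MeasurableSpace X] (E : Setoid X) : Prop
    extends IsCountableBorelEquiv E where
  reducible_of_countable : ∀ (Y : Type) [TopologicalSpace Y] [PolishSpace Y] [MeasurableSpace Y]
    [BorelSpace Y] (F : Setoid Y), IsCountableBorelEquiv F → BorelReducible F E

/-- A point of Cantor space `2^ℕ`, that is, the characteristic function of a set of natural
numbers, as a (total) function `ℕ →. ℕ` with values in `{0, 1}`. -/
def cantorFun (x : ℕ → Bool) : ℕ →. ℕ := fun n => Part.some (x n).toNat

/-- Turing equivalence on Cantor space: `x` and `y` are each computable from the other. -/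
def turingEquiv : Setoid (ℕ → Bool) where
  r x y := TuringEquivalent (cantorFun x) (cantorFun y)
  iseqv :=
    ⟨fun x => TuringEquivalent.refl (cantorFun x), fun h => TuringEquivalent.symm h,
      fun h k => TuringEquivalent.trans _ _ _ h k⟩

/-- The set `𝒟` of Turing degrees (of sets of natural numbers), the quotient of Cantor space by
Turing equivalence. -/
abbrev SetTuringDegree : Type := Quotient turingEquiv

/-- A function `𝒟² → 𝒟` is Borel if it has a Borel lifting `2^ℕ × 2^ℕ → 2^ℕ`. -/
def IsBorelOnDegrees (f : SetTuringDegree × SetTuringDegree → SetTuringDegree) : Prop :=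
  ∃ F : (ℕ → Bool) × (ℕ → Bool) → (ℕ → Bool), Measurable F ∧
    ∀ x y : ℕ → Bool,
      f (Quotient.mk turingEquiv x, Quotient.mk turingEquiv y) = Quotient.mk turingEquiv (F (x, y))

open Set Topology

/-! ### Products of countable Borel equivalence relations -/

/-! The product of a countable Borel equivalence relation with itself is again one, so universality
reduces `E.prod E` to `E`; the diagonal map reduces `E` back.

For the pairing function, a Schröder–Bernstein argument combines the reduction `f` of pairs with the
diagonal: `f` is used on an invariant Borel set `A B`, and the inverse of the diagonal off it
(`exists_measurable_bijective_reduction`). The point is that the pieces stay Borel, which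
`measurableSet_saturation_image` supplies. Fibres of `f` lie in classes enumerated by Turing
functionals, so a direct uniformization (`Continuous.exists_measurableSet_transversal`) reduces
Borelness of images to injective Borel maps. -/

theorem IsCountableBorelEquiv.prod {X Y : Type*} [MeasurableSpace X] [MeasurableSpace Y]
    {E : Setoid X} {F : Setoid Y} (hE : IsCountableBorelEquiv E) (hF : IsCountableBorelEquiv F) :
    IsCountableBorelEquiv (E.prod F) where
  borel := by
    have h₁ : Measurable fun p : (X × Y) × (X × Y) => (p.1.1, p.2.1) := by fun_prop
    have h₂ : Measurable fun p : (X × Y) × (X × Y) => (p.1.2, p.2.2) := by fun_prop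
    exact (h₁ hE.borel).inter (h₂ hF.borel)
  countable_class x := (hE.countable_class x.1).prod (hF.countable_class x.2)

theorem IsCountableBorelEquiv.comap {X Y : Type*} [MeasurableSpace X] [MeasurableSpace Y]
    {E : Setoid X} (hE : IsCountableBorelEquiv E) {g : Y → X} (hg : Measurable g)
    (hinj : Function.Injective g) : IsCountableBorelEquiv (E.comap g) where
  borel := by
    have h : Measurable fun p : Y × Y => (g p.1, g p.2) := by fun_prop
    exact h hE.borel
  countable_class x := (hE.countable_class (g x)).preimage hinj

/-- A universal relation also reduces relations on standard Borel spaces of any universe. -/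
theorem IsUniversalCountableBorelEquiv.reducible {X Y : Type*} [MeasurableSpace X]
    [MeasurableSpace Y] [StandardBorelSpace Y] {E : Setoid X}
    (hE : IsUniversalCountableBorelEquiv E) {F : Setoid Y} (hF : IsCountableBorelEquiv F) :
    BorelReducible F E := by
  -- A Borel copy of `Y` inside `ℝ` lives in `Type`, where universality applies.
  have hemb := MeasureTheory.measurableEmbedding_embeddingReal Y
  let e := hemb.equivRange
  obtain ⟨_, _, _⟩ := hemb.measurableSet_range.standardBorel.polish
  obtain ⟨f, hf, h⟩ := hE.reducible_of_countable _ _ (hF.comap e.symm.measurable e.symm.injective)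
  refine ⟨f ∘ e, hf.comp e.measurable, fun x y => ?_⟩
  rw [Function.comp_apply, Function.comp_apply, ← h]
  change F x y ↔ F (e.symm (e x)) (e.symm (e y))
  simp

theorem BorelReducible.diagonal {X : Type*} [MeasurableSpace X] (E : Setoid X) :
    BorelReducible E (E.prod E) :=
  ⟨fun x => (x, x), by fun_prop, fun _ _ => ⟨fun h => ⟨h, h⟩, fun h => h.1⟩⟩

theorem IsUniversalCountableBorelEquiv.prod_self {X : Type*} [MeasurableSpace X]
    [StandardBorelSpace X] {E : Setoid X} (hE : IsUniversalCountableBorelEquiv E) :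
    BorelBireducible (E.prod E) E :=
  ⟨hE.reducible (hE.toIsCountableBorelEquiv.prod hE.toIsCountableBorelEquiv),
    BorelReducible.diagonal E⟩

/-! ### Transversals of countable-to-one maps -/

/-- Without an isolated point, `C` would be a nonempty perfect set, hence contain an injective image
of Cantor space and be uncountable. -/
theorem IsClosed.exists_isOpen_inter_eq_singleton {X : Type*} [TopologicalSpace X]
    [PolishSpace X] {C : Set X} (hC : IsClosed C) (hcount : C.Countable) (hne : C.Nonempty) :
    ∃ x ∈ C, ∃ U, IsOpen U ∧ U ∩ C = {x} := by
  by_contra! h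
  have hperf : Perfect C := by
    refine ⟨hC, preperfect_iff_nhds.2 fun x hx U hU => ?_⟩
    by_contra! hxU
    refine h x hx (interior U) isOpen_interior (Subset.antisymm ?_ ?_)
    · exact fun y hy => hxU y ⟨interior_subset hy.1, hy.2⟩
    · rintro y rfl
      exact ⟨mem_interior_iff_mem_nhds.2 hU, hx⟩
  let := TopologicalSpace.upgradeIsCompletelyMetrizable X
  obtain ⟨f, hf, -, hinj⟩ := hperf.exists_nat_bool_injection hne
  have hcard : Cardinal.mk (ℕ → Bool) = Cardinal.continuum := by simp
  have : Countable (range f) := (hcount.mono hf).to_subtype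
  have : Countable (ℕ → Bool) := (rangeFactorization_injective.2 hinj).countable
  exact Cardinal.aleph0_lt_continuum.not_ge (hcard ▸ Cardinal.mk_le_aleph0)

/-- Each fibre is closed and countable, so some basic open set isolates a point of it. The
transversal takes the point isolated by the basic set of least index. -/
theorem Continuous.exists_measurableSet_transversal {X Y ι : Type*} [TopologicalSpace X]
    [PolishSpace X] [MeasurableSpace X] [BorelSpace X] [TopologicalSpace Y] [T2Space Y]
    [Countable ι] {f : X → Y} (hf : Continuous f)
    {δ : ι → X → X} (hδ : ∀ i, Measurable (δ i)) (hfδ : ∀ x y, f x = f y → ∃ i, δ i x = y) :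
    ∃ T : Set X, MeasurableSet T ∧ InjOn f T ∧ ∀ x, ∃ t ∈ T, f t = f x := by
  classical
  obtain ⟨b, hbc, -, hb⟩ := TopologicalSpace.exists_countable_basis X
  have hne : b.Nonempty ∨ IsEmpty X := by
    rcases isEmpty_or_nonempty X with h | ⟨⟨x⟩⟩
    · exact Or.inr h
    · obtain ⟨U, hU, -⟩ := hb.mem_nhds_iff.1 (Filter.univ_mem (f := 𝓝 x))
      exact Or.inl ⟨U, hU⟩
  rcases hne with hne | _
  swap
  · exact ⟨∅, .empty, by simp, fun x => isEmptyElim x⟩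
  obtain ⟨U, rfl⟩ := hbc.exists_eq_range hne
  have hUo (n : ℕ) : IsOpen (U n) := hb.isOpen (mem_range_self n)
  let S (n : ℕ) : Set X := {x | ∃ y, U n ∩ f ⁻¹' {f x} = {y}}
  have hfm (i : ι) : MeasurableSet {x | f (δ i x) = f x} :=
    (measurable_id.prodMk (hδ i))
      (isClosed_eq (hf.comp continuous_snd) (hf.comp continuous_fst)).measurableSet
  have hS (n : ℕ) : MeasurableSet (S n) := by
    -- The maps `δ i` turn quantifiers over the fibre into countable ones.
    have : S n = {x | (∃ i, f (δ i x) = f x ∧ δ i x ∈ U n) ∧ ∀ i j, f (δ i x) = f x →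
        δ i x ∈ U n → f (δ j x) = f x → δ j x ∈ U n → δ i x = δ j x} := by
      ext x
      constructor
      · rintro ⟨y, hy⟩
        have hmem (z) : z ∈ U n ∧ f z = f x ↔ z = y := by
          simpa using Set.ext_iff.1 hy z
        obtain ⟨i, hi⟩ := hfδ x y ((hmem y).2 rfl).2.symm
        refine ⟨⟨i, ?_, ?_⟩, fun i j h₁ h₂ h₃ h₄ => ?_⟩
        · rw [hi]; exact ((hmem y).2 rfl).2
        · rw [hi]; exact ((hmem y).2 rfl).1
        · rw [(hmem _).1 ⟨h₂, h₁⟩, (hmem _).1 ⟨h₄, h₃⟩]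
      · rintro ⟨⟨i, h₁, h₂⟩, h⟩
        refine ⟨δ i x, Subset.antisymm ?_ ?_⟩
        · rintro z ⟨hz, hzx⟩
          obtain ⟨j, rfl⟩ := hfδ x z hzx.symm
          exact h j i hzx hz h₁ h₂
        · rintro z rfl
          exact ⟨h₂, h₁⟩
    rw [this]
    have hU' (i) : MeasurableSet {x | δ i x ∈ U n} := hδ i (hUo n).measurableSet
    simp only [imp_iff_not_or]
    have hex : MeasurableSet {x | ∃ i, f (δ i x) = f x ∧ δ i x ∈ U n} := by
      simp only [ofPred_exists]
      exact .iUnion fun i => (hfm i).inter (hU' i)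
    have hall : MeasurableSet {x | ∀ i j, ¬ f (δ i x) = f x ∨ δ i x ∉ U n ∨
        ¬ f (δ j x) = f x ∨ δ j x ∉ U n ∨ δ i x = δ j x} := by
      simp only [ofPred_forall]
      refine .iInter fun i => .iInter fun j => ?_
      exact (hfm i).compl.union <| (hU' i).compl.union <| (hfm j).compl.union <|
        (hU' j).compl.union (measurableSet_eq_fun (hδ i) (hδ j))
    exact hex.inter hall
  have hSf {x y : X} (h : f x = f y) (n : ℕ) : x ∈ S n ↔ y ∈ S n := by
    simp only [S, mem_ofPred_eq, h]
  refine ⟨⋃ n, (U n ∩ S n) ∩ ⋂ m : Iio n, (S m)ᶜ, ?_, ?_, fun x => ?_⟩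
  · exact .iUnion fun n => ((hUo n).measurableSet.inter (hS n)).inter
      (.iInter fun m => (hS m).compl)
  · intro x hx y hy hxy
    simp only [mem_iUnion, mem_inter_iff, mem_iInter, mem_compl_iff, Subtype.forall,
      mem_Iio] at hx hy
    obtain ⟨n, ⟨hxn, z, hz⟩, hn⟩ := hx
    obtain ⟨m, ⟨hym, hyS⟩, hm⟩ := hy
    obtain rfl : n = m := by
      refine le_antisymm (not_lt.1 fun h => hn m h ((hSf hxy m).2 hyS)) (not_lt.1 fun h => ?_)
      exact hm n h ((hSf hxy n).1 ⟨z, hz⟩)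
    have h₁ : x ∈ ({z} : Set X) := hz ▸ ⟨hxn, rfl⟩
    have h₂ : y ∈ ({z} : Set X) := hz ▸ ⟨hym, hxy.symm⟩
    exact h₁.trans h₂.symm
  · have hcount : (f ⁻¹' {f x}).Countable := by
      refine (countable_range fun i => δ i x).mono fun y hy => ?_
      exact hfδ x y (Eq.symm hy)
    obtain ⟨y, hy, V, hV, hVy⟩ := (isClosed_singleton.preimage hf).exists_isOpen_inter_eq_singleton
      hcount ⟨x, rfl⟩
    have hex : ∃ n, x ∈ S n := by
      have hyV : y ∈ V := (hVy ▸ mem_singleton y : y ∈ V ∩ _).1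
      obtain ⟨-, ⟨n, rfl⟩, hyn, hnV⟩ := hb.mem_nhds_iff.1 (hV.mem_nhds hyV)
      refine ⟨n, y, Subset.antisymm ?_ ?_⟩
      · rw [← hVy]
        exact inter_subset_inter_left _ hnV
      · rintro z rfl
        exact ⟨hyn, hy⟩
    obtain ⟨t, ht⟩ := Nat.find_spec hex
    have htm : t ∈ U (Nat.find hex) ∩ f ⁻¹' {f x} := ht ▸ mem_singleton t
    have htx : f t = f x := htm.2
    refine ⟨t, mem_iUnion.2 ⟨Nat.find hex, ⟨htm.1, (hSf htx _).2 (Nat.find_spec hex)⟩, ?_⟩, htx⟩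
    simp only [mem_iInter, mem_compl_iff, Subtype.forall, mem_Iio]
    exact fun m hm hmS => Nat.find_min hex hm ((hSf htx _).1 hmS)

/-- A finer Polish topology makes `f` continuous without changing the Borel sets. -/
theorem Measurable.exists_measurableSet_transversal {X Y ι : Type*} [MeasurableSpace X]
    [StandardBorelSpace X] [TopologicalSpace Y] [SecondCountableTopology Y] [T2Space Y]
    [MeasurableSpace Y] [BorelSpace Y] [Countable ι] {f : X → Y} (hf : Measurable f)
    {δ : ι → X → X} (hδ : ∀ i, Measurable (δ i)) (hfδ : ∀ x y, f x = f y → ∃ i, δ i x = y) :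
    ∃ T : Set X, MeasurableSet T ∧ InjOn f T ∧ ∀ x, ∃ t ∈ T, f t = f x := by
  let := upgradeStandardBorel X
  let t₀ : TopologicalSpace X := inferInstance
  have hpol₀ : @PolishSpace X t₀ := inferInstance
  obtain ⟨t, hle, hcont, hpol⟩ := hf.exists_continuous
  have hborel : @BorelSpace X t _ :=
    @BorelSpace.mk X t _ ((eq_borel_upgradeStandardBorel X).trans
      (MeasureTheory.borel_eq_borel_of_le hpol hpol₀ hle).symm)
  exact @Continuous.exists_measurableSet_transversal X Y ι t hpol _ hborel _ _ _ f hcont δ hδ hfδ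

/-- The image of an invariant measurable set under a measurable map whose fibres are enumerated by
countably many measurable maps is measurable. -/
theorem MeasurableSet.image_of_enumerated_fibers {X Y ι : Type*} [MeasurableSpace X]
    [StandardBorelSpace X] [TopologicalSpace Y] [SecondCountableTopology Y] [T2Space Y]
    [MeasurableSpace Y] [BorelSpace Y] [Countable ι] {f : X → Y} (hf : Measurable f)
    {δ : ι → X → X} (hδ : ∀ i, Measurable (δ i)) (hfδ : ∀ x y, f x = f y → ∃ i, δ i x = y)
    {A : Set X} (hA : MeasurableSet A) (hAf : ∀ x y, f x = f y → x ∈ A → y ∈ A) :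
    MeasurableSet (f '' A) := by
  obtain ⟨T, hT, hinj, hex⟩ := hf.exists_measurableSet_transversal hδ hfδ
  -- By invariance, `A` contains the representative in `T` of every fibre it meets.
  have : f '' A = f '' (A ∩ T) := by
    refine Subset.antisymm ?_ (image_mono inter_subset_left)
    rintro - ⟨x, hx, rfl⟩
    obtain ⟨t, ht, htx⟩ := hex x
    exact ⟨t, ⟨hAf x t htx.symm hx, ht⟩, htx⟩
  rw [this]
  exact (hA.inter hT).image_of_measurable_injOn hf (hinj.mono inter_subset_right)

/-! ### Enumerating Turing degrees -/

/-- Codes for oracle computations with a single oracle. -/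
inductive OracleCode : Type
  | zero : OracleCode
  | succ : OracleCode
  | left : OracleCode
  | right : OracleCode
  | oracle : OracleCode
  | pair : OracleCode → OracleCode → OracleCode
  | comp : OracleCode → OracleCode → OracleCode
  | prec : OracleCode → OracleCode → OracleCode
  | rfind : OracleCode → OracleCode
  deriving Countable

namespace OracleCode

/-- The partial function computed by a code relative to the oracle `g`. -/
def eval (g : ℕ →. ℕ) : OracleCode → (ℕ →. ℕ)
  | zero => fun _ => 0
  | succ => Nat.succ
  | left => fun n => (Nat.unpair n).1
  | right => fun n => (Nat.unpair n).2
  | oracle => g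
  | pair c d => fun n => Nat.pair <$> c.eval g n <*> d.eval g n
  | comp c d => fun n => d.eval g n >>= c.eval g
  | prec c d => fun p =>
      let (a, n) := Nat.unpair p
      n.rec (c.eval g a) fun y IH => do
        let i ← IH
        d.eval g (Nat.pair a (Nat.pair y i))
  | rfind c => fun a => Nat.rfind fun n => (fun m => m = 0) <$> c.eval g (Nat.pair a n)

theorem exists_eval_eq {g f : ℕ →. ℕ} (h : Nat.RecursiveIn {g} f) :
    ∃ c : OracleCode, c.eval g = f := by
  induction h with
  | zero => exact ⟨zero, rfl⟩
  | succ => exact ⟨succ, rfl⟩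
  | left => exact ⟨left, rfl⟩
  | right => exact ⟨right, rfl⟩
  | oracle k hk => exact ⟨oracle, (mem_singleton_iff.1 hk).symm⟩
  | pair _ _ hf hh =>
    obtain ⟨c, rfl⟩ := hf
    obtain ⟨d, rfl⟩ := hh
    exact ⟨pair c d, rfl⟩
  | comp _ _ hf hh =>
    obtain ⟨c, rfl⟩ := hf
    obtain ⟨d, rfl⟩ := hh
    exact ⟨comp c d, rfl⟩
  | prec _ _ hf hh =>
    obtain ⟨c, rfl⟩ := hf
    obtain ⟨d, rfl⟩ := hh
    exact ⟨prec c d, rfl⟩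
  | rfind _ hf =>
    obtain ⟨c, rfl⟩ := hf
    exact ⟨rfind c, rfl⟩

/-- Convergence to a given value depends on countably many intermediate values, so each constructor
is a countable Boolean operation. -/
theorem measurableSet_mem_eval {X : Type*} [MeasurableSpace X] {g : X → ℕ →. ℕ}
    (hg : ∀ n m, MeasurableSet {x | m ∈ g x n}) (c : OracleCode) (n m : ℕ) :
    MeasurableSet {x | m ∈ c.eval (g x) n} := by
  induction c generalizing n m with
  | zero => exact .const (m ∈ Part.some 0)
  | succ => exact .const (m ∈ Part.some (n.succ))
  | left => exact .const (m ∈ Part.some (n.unpair.1))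
  | right => exact .const (m ∈ Part.some (n.unpair.2))
  | oracle => exact hg n m
  | pair c d hc hd =>
    have : {x | m ∈ (pair c d).eval (g x) n} =
        ⋃ i, ⋃ j, {x | i ∈ c.eval (g x) n} ∩ ({x | j ∈ d.eval (g x) n} ∩
          {_x | Nat.pair i j = m}) := by
      ext x
      simp [eval, Seq.seq]
    rw [this]
    exact .iUnion fun i => .iUnion fun j => (hc n i).inter ((hd n j).inter (.const _))
  | comp c d hc hd =>
    have : {x | m ∈ (comp c d).eval (g x) n} =
        ⋃ i, {x | i ∈ d.eval (g x) n} ∩ {x | m ∈ c.eval (g x) i} := by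
      ext x
      simp only [mem_iUnion, mem_inter_iff, mem_ofPred_eq]
      exact Part.mem_bind_iff
    rw [this]
    exact .iUnion fun i => (hd n i).inter (hc i m)
  | prec c d hc hd =>
    simp only [eval]
    generalize (Nat.unpair n).1 = a
    generalize (Nat.unpair n).2 = k
    induction k generalizing m with
    | zero => exact hc a m
    | succ k ih =>
      simp only [Part.bind_eq_bind, Part.mem_bind_iff, ofPred_exists, ofPred_and]
      exact .iUnion fun i => (ih i).inter (hd _ m)
  | rfind c hc =>
    have : {x | m ∈ (rfind c).eval (g x) n} =
        {x | 0 ∈ c.eval (g x) (Nat.pair n m)} ∩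
          ⋂ k : Iio m, ⋃ i, {x | i ∈ c.eval (g x) (Nat.pair n k)} ∩ {_x | i ≠ 0} := by
      ext x
      refine Nat.mem_rfind.trans ?_
      simp
    rw [this]
    exact (hc _ 0).inter (.iInter fun k => .iUnion fun i => (hc _ i).inter (.const _))

open Classical in
/-- The Turing functional with code `c`, made total on Cantor space. -/
noncomputable def functional (c : OracleCode) (x : ℕ → Bool) : ℕ → Bool :=
  fun n => decide (1 ∈ c.eval (cantorFun x) n)

theorem measurable_functional (c : OracleCode) : Measurable c.functional := by
  classical
  refine measurable_pi_lambda _ fun n => measurable_to_bool ?_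
  have : (fun x => c.functional x n) ⁻¹' {true} = {x | 1 ∈ c.eval (cantorFun x) n} := by
    ext x
    simp [functional]
  rw [this]
  refine measurableSet_mem_eval (fun n m => ?_) c n 1
  have h : Measurable fun x : ℕ → Bool => (x n).toNat :=
    (measurable_of_countable Bool.toNat).comp (measurable_pi_apply n)
  have hm : {x : ℕ → Bool | m ∈ cantorFun x n} = (fun x => (x n).toNat) ⁻¹' {m} := by
    ext x
    simp [cantorFun, eq_comm]
  exact hm ▸ h (measurableSet_singleton m)

theorem exists_functional_eq {x y : ℕ → Bool} (h : turingEquiv x y) :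
    ∃ c : OracleCode, c.functional x = y := by
  classical
  obtain ⟨c, hc⟩ := exists_eval_eq (RecursiveIn.iff_nat.1 h.2)
  refine ⟨c, funext fun n => ?_⟩
  cases hy : y n <;> simp [functional, hc, cantorFun, hy]

end OracleCode

/-! ### The Schröder–Bernstein argument -/

/-- The saturation of the image of an invariant Borel set under a Borel reduction to Turing
equivalence is Borel. -/
theorem measurableSet_saturation_image {f : (ℕ → Bool) × (ℕ → Bool) → (ℕ → Bool)}
    (hT : IsCountableBorelEquiv turingEquiv) (hf : Measurable f)
    (hred : ∀ p q, turingEquiv.prod turingEquiv p q ↔ turingEquiv (f p) (f q))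
    {A : Set ((ℕ → Bool) × (ℕ → Bool))} (hA : MeasurableSet A)
    (hinv : ∀ p q, turingEquiv.prod turingEquiv p q → p ∈ A → q ∈ A) :
    MeasurableSet {z | ∃ p ∈ A, turingEquiv (f p) z} := by
  have hfE {p q} (h : f p = f q) : turingEquiv.prod turingEquiv p q :=
    (hred p q).2 (h ▸ turingEquiv.refl _)
  have himg : MeasurableSet (f '' A) := by
    refine hA.image_of_enumerated_fibers hf
      (δ := fun (c : OracleCode × OracleCode) p => (c.1.functional p.1, c.2.functional p.2))
      (fun c => (c.1.measurable_functional.comp measurable_fst).prodMk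
        (c.2.measurable_functional.comp measurable_snd)) (fun p q h => ?_)
      (fun p q h => hinv p q (hfE h))
    obtain ⟨c, hc⟩ := OracleCode.exists_functional_eq (hfE h).1
    obtain ⟨d, hd⟩ := OracleCode.exists_functional_eq (hfE h).2
    exact ⟨(c, d), Prod.ext hc hd⟩
  -- A functional may leave the degree of `z`; the first condition keeps only those that stay in it.
  have : {z | ∃ p ∈ A, turingEquiv (f p) z} =
      ⋃ c : OracleCode, {z | turingEquiv z (c.functional z)} ∩ c.functional ⁻¹' (f '' A) := by
    ext z
    simp only [mem_ofPred_eq, mem_iUnion, mem_inter_iff, mem_preimage, mem_image]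
    constructor
    · rintro ⟨p, hp, h⟩
      obtain ⟨c, hc⟩ := OracleCode.exists_functional_eq (turingEquiv.symm h)
      exact ⟨c, hc ▸ turingEquiv.symm h, p, hp, hc.symm⟩
    · rintro ⟨c, hc, p, hp, h⟩
      exact ⟨p, hp, h ▸ turingEquiv.symm hc⟩
  rw [this]
  refine .iUnion fun c => .inter ?_ (c.measurable_functional himg)
  exact (measurable_id.prodMk c.measurable_functional) hT.borel

/-- A Borel reduction of pairs to Turing equivalence can be turned into a Borel map inducing a
bijection of the quotients. -/
theorem exists_measurable_bijective_reduction (hT : IsCountableBorelEquiv turingEquiv)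
    (h : BorelReducible (turingEquiv.prod turingEquiv) turingEquiv) :
    ∃ F : (ℕ → Bool) × (ℕ → Bool) → (ℕ → Bool), Measurable F ∧
      (∀ p q, turingEquiv.prod turingEquiv p q ↔ turingEquiv (F p) (F q)) ∧
      ∀ z, ∃ p, turingEquiv (F p) z := by
  classical
  obtain ⟨f, hf, hred⟩ := h
  let A (B : Set (ℕ → Bool)) : Set ((ℕ → Bool) × (ℕ → Bool)) :=
    {p | ¬ turingEquiv p.1 p.2 ∨ p.1 ∈ B}
  let S (B : Set (ℕ → Bool)) : Set (ℕ → Bool) := {z | ∃ p ∈ A B, turingEquiv (f p) z}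
  -- The union of these iterates is a fixed point of `S`: membership in `A` of the union is already
  -- witnessed at a finite stage.
  let b (n : ℕ) : Set (ℕ → Bool) := S^[n] ∅
  have hbs (n : ℕ) : b (n + 1) = S (b n) := Function.iterate_succ_apply' S n ∅
  have hSinv (B) {x y} (hxy : turingEquiv x y) (hx : x ∈ S B) : y ∈ S B := by
    obtain ⟨p, hp, hpx⟩ := hx
    exact ⟨p, hp, turingEquiv.trans hpx hxy⟩
  have hbinv (n : ℕ) {x y} (hxy : turingEquiv x y) (hx : x ∈ b n) : y ∈ b n := by
    cases n with
    | zero => exact hx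
    | succ n =>
      rw [hbs] at hx ⊢
      exact hSinv _ hxy hx
  have hAinv {B : Set (ℕ → Bool)} (hB : ∀ x y, turingEquiv x y → x ∈ B → y ∈ B) (p q)
      (hpq : turingEquiv.prod turingEquiv p q) (hp : p ∈ A B) : q ∈ A B := by
    refine hp.imp (fun h h' => h ?_) (hB _ _ hpq.1)
    exact turingEquiv.trans hpq.1 (turingEquiv.trans h' (turingEquiv.symm hpq.2))
  have hAm {B : Set (ℕ → Bool)} (hB : MeasurableSet B) : MeasurableSet (A B) :=
    hT.borel.compl.union (measurable_fst hB)
  have hbm (n : ℕ) : MeasurableSet (b n) := by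
    induction n with
    | zero => exact .empty
    | succ n ih =>
      rw [hbs]
      exact measurableSet_saturation_image hT hf hred (hAm ih) (hAinv fun _ _ => hbinv n)
  let B := ⋃ n, b n
  have hBinv (x y) (hxy : turingEquiv x y) (hx : x ∈ B) : y ∈ B := by
    obtain ⟨n, hn⟩ := mem_iUnion.1 hx
    exact mem_iUnion.2 ⟨n, hbinv n hxy hn⟩
  have hBm : MeasurableSet B := .iUnion hbm
  have hmono {B C : Set (ℕ → Bool)} (h : B ⊆ C) : S B ⊆ S C := by
    rintro z ⟨p, hp, hz⟩
    exact ⟨p, hp.imp id (@h _), hz⟩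
  have hBS : B = S B := by
    refine Subset.antisymm (iUnion_subset fun n => ?_) ?_
    · cases n with
      | zero => exact empty_subset _
      | succ n =>
        rw [hbs]
        exact hmono (subset_iUnion b n)
    · rintro z ⟨p, hp | hp, hz⟩
      · exact mem_iUnion.2 ⟨1, hbs 0 ▸ ⟨p, Or.inl hp, hz⟩⟩
      · obtain ⟨n, hn⟩ := mem_iUnion.1 hp
        exact mem_iUnion.2 ⟨n + 1, hbs n ▸ ⟨p, Or.inr hn, hz⟩⟩
  have hsep {p q} (hp : p ∈ A B) (hq : q ∉ A B) : ¬ turingEquiv (f p) q.1 := fun hpq => by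
    refine hq (Or.inr ?_)
    rw [hBS]
    exact ⟨p, hp, hpq⟩
  have hdiag {p} (hp : p ∉ A B) : turingEquiv p.1 p.2 := not_not.1 fun h => hp (Or.inl h)
  -- Off `A B` the two coordinates are equivalent, so `p.1` inverts the diagonal up to equivalence.
  -- The fixed point property makes `f` cover exactly the degrees in `B`, and the diagonal part
  -- those outside.
  refine ⟨fun p => if p ∈ A B then f p else p.1, hf.ite (hAm hBm) measurable_fst,
    fun p q => ?_, fun z => ?_⟩
  · have hiff (h : turingEquiv.prod turingEquiv p q) : p ∈ A B ↔ q ∈ A B :=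
      ⟨hAinv hBinv p q h, hAinv hBinv q p ((turingEquiv.prod turingEquiv).symm h)⟩
    by_cases hp : p ∈ A B <;> by_cases hq : q ∈ A B <;> simp only [hp, hq, if_true, if_false]
    · exact hred p q
    · exact iff_of_false (fun h => hq ((hiff h).1 hp)) (hsep hp hq)
    · exact iff_of_false (fun h => hp ((hiff h).2 hq)) fun h => hsep hq hp (turingEquiv.symm h)
    · refine ⟨fun h => h.1, fun h => ⟨h, ?_⟩⟩
      exact turingEquiv.trans (turingEquiv.symm (hdiag hp)) (turingEquiv.trans h (hdiag hq))
  · by_cases hz : z ∈ B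
    · obtain ⟨p, hp, hpz⟩ : z ∈ S B := hBS ▸ hz
      exact ⟨p, by simpa only [hp, if_true] using hpz⟩
    · have : (z, z) ∉ A B := fun h => h.elim (fun h => h (turingEquiv.refl z)) hz
      exact ⟨(z, z), by simpa only [this, if_false] using turingEquiv.refl z⟩

theorem exists_bijective_isBorelOnDegrees
    {F : (ℕ → Bool) × (ℕ → Bool) → (ℕ → Bool)} (hF : Measurable F)
    (hred : ∀ p q, turingEquiv.prod turingEquiv p q ↔ turingEquiv (F p) (F q))
    (hsurj : ∀ z, ∃ p, turingEquiv (F p) z) :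
    ∃ f : SetTuringDegree × SetTuringDegree → SetTuringDegree,
      Function.Bijective f ∧ IsBorelOnDegrees f := by
  let f (d : SetTuringDegree × SetTuringDegree) : SetTuringDegree :=
    Quotient.map₂ (fun x y => F (x, y))
      (fun x x' hx y y' hy => (hred (x, y) (x', y')).1 ⟨hx, hy⟩) d.1 d.2
  refine ⟨f, ⟨?_, fun d => ?_⟩, F, hF, fun _ _ => rfl⟩
  · rintro ⟨d, e⟩ ⟨d', e'⟩ h
    induction d, e using Quotient.inductionOn₂ with | _ x y
    induction d', e' using Quotient.inductionOn₂ with | _ x' y'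
    have := (hred (x, y) (x', y')).2 (Quotient.exact h)
    exact Prod.ext (Quotient.sound this.1) (Quotient.sound this.2)
  · induction d using Quotient.inductionOn with | _ z
    obtain ⟨p, hp⟩ := hsurj z
    exact ⟨(Quotient.mk _ p.1, Quotient.mk _ p.2), Quotient.sound hp⟩

theorem mainTheorem5 :
    (∀ {X : Type*} [TopologicalSpace X] [PolishSpace X] [MeasurableSpace X] [BorelSpace X]
      (E : Setoid X), IsUniversalCountableBorelEquiv E → BorelBireducible (E.prod E) E) ∧
    (IsUniversalCountableBorelEquiv turingEquiv →
      BorelBireducible (turingEquiv.prod turingEquiv) turingEquiv ∧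
      ∃ f : SetTuringDegree × SetTuringDegree → SetTuringDegree,
        Function.Bijective f ∧ IsBorelOnDegrees f) := by
  refine ⟨fun E hE => hE.prod_self, fun hT => ⟨hT.prod_self, ?_⟩⟩
  obtain ⟨F, hF, hred, hsurj⟩ :=
    exists_measurable_bijective_reduction hT.toIsCountableBorelEquiv hT.prod_self.1
  exact exists_bijective_isBorelOnDegrees hF hred hsurj
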